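/- Let $k$ be a field and let $\mathcal T$ be a $k$-linear, Hom-finite, Krull-Schmidt triangulated category with suspension $[1]$ (a $k$-linear autoequivalence). For $G\in\mathcal T$ let $\langle G\rangle_1$ denote the smallest full additive subcategory of $\mathcal T$ containing $G$ and closed under direct summands and under $[1]$ and $[-1]$; $G$ is a *classical generator* if the smallest thick subcategory of $\mathcal T$ containing $G$ is $\mathcal T$. For indecomposable objects $P,Q\in\langle G\rangle_1$ write $Q\le P$ if $\mathrm{Hom}_{\mathcal T}(P,Q)\cong k$, and $Q<P$ if moreover $Q\not\cong P$. A classical generator $G$ is a *linear generator* if the following hold for indecomposable objects of $\langle G\rangle_1$: 1. $\le$ induces a total order on isomorphism classes, and $\mathrm{Hom}_{\mathcal T}(Q,P)=0$ whenever $Q<P$; 2. $P\le P[1]$ for all $P$; 3. if $P\le Q\le P[1]$, then $Q\cong P$ or $Q\cong P[1]$; 4. if $R\le Q\le P$, then every nonzero morphism $P\to R$ factors through $Q$. It is *minimal* if no proper direct summand of $G$ is a classical generator of $\mathcal T$. The graded endomorphism algebra of $G$ is $\mathrm{End}^*_{\mathcal T}(G)=\bigoplus_{n\in\mathbb Z}\mathrm{Hom}_{\mathcal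 T}(G,G[n])$ with product $g\cdot f=g[j]\circ f$ for $f\in\mathrm{Hom}_{\mathcal T}(G,G[j])$ and $g\in\mathrm{Hom}_{\mathcal T}(G,G[i])$. **Proposition.** Let $G$ be a minimal linear generator of $\mathcal T$ and let $G\cong\bigoplus_{i=1}^m G_i$ with $G_1,\dots,G_m$ indecomposable. Then, after reordering, $G_1<G_2<\dots<G_m$, and with this ordering $\mathrm{End}^*_{\mathcal T}(G)$ is isomorphic, as a graded $k$-algebra, to the upper triangular $m\times m$ matrix algebra $\chi^G$ with entries $$\chi^G_{i,j}=\begin{cases} k[x] & \text{if } i=j \text{ and } G_i<G_i[1],\\ 0 & \text{if } j<i,\\ k[x^{\pm}] & \text{otherwise,}\end{cases}$$ with matrix multiplication inside $M_m(k[x^{\pm}])$, graded by placing $x$ in degree $-1$ (so a matrix is homogeneous of degree $n$ if all its entries are scalar multiples of $x^{-n}$). -/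

import Mathlib

open CategoryTheory CategoryTheory.Limits

universe w v u

noncomputable section

namespace LinGen

/-! ### Graded endomorphism algebras -/

section GradedEnd

variable {C : Type u} [Category.{v} C] [HasShift C ℤ]

/-- The degree `n` part `Endⁿ(G) = Hom(G, G[n])` of the graded endomorphism algebra of `G`. -/
def EndDeg (G : C) (n : ℤ) : Type v := ShiftedHom G G n

/-- The product of `g ∈ Endⁱ(G)` and `f ∈ Endʲ(G)` is `g[j] ∘ f ∈ Endⁱ⁺ʲ(G)`
(with the identification `G[i][j] = G[i + j]`, which is part of `ShiftedHom.comp`). -/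
def EndDeg.mul {G : C} {i j : ℤ} (g : EndDeg G i) (f : EndDeg G j) : EndDeg G (i + j) :=
  ShiftedHom.comp (X := G) (Y := G) (Z := G) f g rfl

/-- The identity of `G`, as an element of degree zero. -/
def EndDeg.one (G : C) : EndDeg G 0 := ShiftedHom.mk₀ (0 : ℤ) rfl (𝟙 G)


theorem EndDeg.mk_comp_congr {G : C} {i j c c' : ℤ} (f : ShiftedHom G G j) (g : ShiftedHom G G i)
    (h : i + j = c) (h' : i + j = c') :
    (⟨c, f.comp g h⟩ : GradedMonoid (EndDeg G)) = ⟨c', f.comp g h'⟩ := by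
  subst h
  subst h'
  rfl

instance (G : C) : GradedMonoid.GMul (EndDeg G) := ⟨fun g f => EndDeg.mul g f⟩

instance (G : C) : GradedMonoid.GOne (EndDeg G) := ⟨EndDeg.one G⟩

instance (G : C) : GradedMonoid.GMonoid (EndDeg G) where
  one_mul := by
    rintro ⟨j, f⟩
    refine (EndDeg.mk_comp_congr (G := G) f (ShiftedHom.mk₀ (0 : ℤ) rfl (𝟙 G)) rfl
      (zero_add j)).trans ?_
    exact congrArg (Sigma.mk j) (ShiftedHom.comp_mk₀_id (X := G) (Y := G) f 0 rfl)
  mul_one := by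
    rintro ⟨j, f⟩
    refine (EndDeg.mk_comp_congr (G := G) (ShiftedHom.mk₀ (0 : ℤ) rfl (𝟙 G)) f rfl
      (add_zero j)).trans ?_
    exact congrArg (Sigma.mk j) (ShiftedHom.mk₀_id_comp (X := G) (Y := G) 0 rfl f)
  mul_assoc := by
    rintro ⟨a, x⟩ ⟨b, y⟩ ⟨c, z⟩
    refine Eq.trans ?_ (EndDeg.mk_comp_congr (G := G) (ShiftedHom.comp (X := G) (Y := G) (Z := G)
      z y rfl) x (add_assoc a b c).symm rfl)
    exact congrArg (Sigma.mk _) (ShiftedHom.comp_assoc (X := G) (Y := G) (Z := G) (T := G)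
      z y x rfl rfl rfl).symm

variable [Preadditive C]

instance (G : C) (n : ℤ) : AddCommGroup (EndDeg G n) :=
  inferInstanceAs (AddCommGroup (G ⟶ G⟦n⟧))

instance (k : Type w) [Field k] [Linear k C] (G : C) (n : ℤ) : Module k (EndDeg G n) :=
  inferInstanceAs (Module k (G ⟶ G⟦n⟧))

instance (G : C) [∀ n : ℤ, (shiftFunctor C n).Additive] : DirectSum.GSemiring (EndDeg G) where
  __ := (inferInstance : GradedMonoid.GMonoid (EndDeg G))
  mul_zero {_ j} g := ShiftedHom.zero_comp (Y := G) (Z := G) G j g rfl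
  zero_mul {_ _} f := ShiftedHom.comp_zero (X := G) (Y := G) G f rfl
  mul_add {_ _} g f₁ f₂ := ShiftedHom.add_comp (X := G) (Y := G) (Z := G) f₁ f₂ g rfl
  add_mul {_ _} g₁ g₂ f := ShiftedHom.comp_add (X := G) (Y := G) (Z := G) f g₁ g₂ rfl
  natCast n := n • EndDeg.one G
  natCast_zero := zero_smul _ _
  natCast_succ n := succ_nsmul _ n

instance (k : Type w) [Field k] [Linear k C] (G : C) [∀ n : ℤ, (shiftFunctor C n).Additive]
    [∀ n : ℤ, (shiftFunctor C n).Linear k] : DirectSum.GAlgebra k (EndDeg G) where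
  toFun :=
    { toFun := fun r => r • EndDeg.one G
      map_zero' := zero_smul _ _
      map_add' := fun r s => add_smul _ _ _ }
  map_one := one_smul _ _
  map_mul r s := by
    have h : EndDeg.mul (r • EndDeg.one G) (s • EndDeg.one G) =
        (r * s) • EndDeg.mul (EndDeg.one G) (EndDeg.one G) := by
      refine (ShiftedHom.smul_comp (X := G) (Y := G) (Z := G) s _ _ rfl).trans ?_
      rw [mul_comm, mul_smul]
      exact congrArg (s • ·) (ShiftedHom.comp_smul (X := G) (Y := G) (Z := G) r _ _ rfl)
    refine Eq.trans ?_ (congrArg (Sigma.mk _) h).symm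
    exact congrArg (fun x : GradedMonoid (EndDeg G) => (r * s) • x)
      (@mul_one (GradedMonoid (EndDeg G)) _ 1).symm
  commutes := by
    rintro r ⟨j, f⟩
    have h₁ : EndDeg.mul (r • EndDeg.one G) f = r • EndDeg.mul (EndDeg.one G) f :=
      ShiftedHom.comp_smul (X := G) (Y := G) (Z := G) r _ _ rfl
    have h₂ : EndDeg.mul f (r • EndDeg.one G) = r • EndDeg.mul f (EndDeg.one G) :=
      ShiftedHom.smul_comp (X := G) (Y := G) (Z := G) r _ _ rfl
    refine (congrArg (Sigma.mk _) h₁).trans (Eq.trans ?_ (congrArg (Sigma.mk _) h₂).symm)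
    exact congrArg (fun x : GradedMonoid (EndDeg G) => r • x)
      ((@one_mul (GradedMonoid (EndDeg G)) _ ⟨j, f⟩).trans
        (@mul_one (GradedMonoid (EndDeg G)) _ ⟨j, f⟩).symm)
  smul_def := by
    rintro r ⟨j, f⟩
    have h₁ : EndDeg.mul (r • EndDeg.one G) f = r • EndDeg.mul (EndDeg.one G) f :=
      ShiftedHom.comp_smul (X := G) (Y := G) (Z := G) r _ _ rfl
    refine Eq.trans ?_ (congrArg (Sigma.mk _) h₁).symm
    exact congrArg (fun x : GradedMonoid (EndDeg G) => r • x)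
      (@one_mul (GradedMonoid (EndDeg G)) _ ⟨j, f⟩).symm

/-- The graded endomorphism algebra `End*(G) = ⨁ₙ Hom(G, G[n])`. Its ring and `k`-algebra
structures are those of an external direct sum with the graded product `EndDeg.mul`. -/
abbrev EndStar (G : C) : Type v := DirectSum ℤ (EndDeg G)

/-- The homogeneous elements of degree `n` in `End*(G)`. -/
def EndStar.homogeneous (k : Type w) [Field k] [Linear k C] (G : C) (n : ℤ) :
    Submodule k (EndStar G) :=
  LinearMap.range (DirectSum.lof k ℤ (EndDeg G) n)

end GradedEnd

/-! ### The triangular matrix algebra -/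

section Chi

open LaurentPolynomial

variable (k : Type w) [Field k] {m : ℕ}

/-- The algebra of upper triangular `m × m` matrices whose entries above the diagonal lie in
`k[x, x⁻¹]` and whose `i`-th diagonal entry lies in `k[x]` if `S i` holds, and in `k[x, x⁻¹]`
otherwise. Here `k[x]` is viewed inside `k[x, x⁻¹] = k[T;T⁻¹]`, where `x = T 1`. -/
def chi (S : Fin m → Prop) : Subalgebra k (Matrix (Fin m) (Fin m) k[T;T⁻¹]) where
  carrier := {M | (∀ i j, j < i → M i j = 0) ∧
    ∀ i, S i → M i i ∈ (Polynomial.toLaurentAlg (R := k)).range}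
  mul_mem' := by
    rintro M N ⟨hM, hM'⟩ ⟨hN, hN'⟩
    refine ⟨fun i j hij => ?_, fun i hi => ?_⟩
    · rw [Matrix.mul_apply]
      refine Finset.sum_eq_zero fun l _ => ?_
      rcases lt_or_ge l i with h | h
      · rw [hM i l h, zero_mul]
      · rw [hN l j (lt_of_lt_of_le hij h), mul_zero]
    · rw [Matrix.mul_apply, Finset.sum_eq_single i]
      · exact mul_mem (hM' i hi) (hN' i hi)
      · intro l _ hl
        rcases lt_or_gt_of_ne hl with h | h
        · rw [hM i l h, zero_mul]
        · rw [hN l i h, mul_zero]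
      · intro h
        exact absurd (Finset.mem_univ i) h
  add_mem' := by
    rintro M N ⟨hM, hM'⟩ ⟨hN, hN'⟩
    refine ⟨fun i j hij => ?_, fun i hi => ?_⟩
    · rw [Matrix.add_apply, hM i j hij, hN i j hij, add_zero]
    · exact add_mem (hM' i hi) (hN' i hi)
  algebraMap_mem' r := by
    refine ⟨fun i j hij => ?_, fun i _ => ?_⟩
    · rw [Matrix.algebraMap_matrix_apply, if_neg hij.ne']
    · rw [Matrix.algebraMap_matrix_apply, if_pos rfl]
      exact Subalgebra.algebraMap_mem _ r

/-- The homogeneous elements of degree `n` in the matrix algebra, where `x` has degree `-1`: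
the matrices in the algebra all of whose entries are scalar multiples of `x⁻ⁿ`. -/
def chi.homogeneous (S : Fin m → Prop) (n : ℤ) : Submodule k (chi k S) where
  carrier := {M | ∀ i j, ∃ a : k, (M : Matrix (Fin m) (Fin m) k[T;T⁻¹]) i j = a • T (-n)}
  zero_mem' _ _ := ⟨0, by rw [zero_smul]; rfl⟩
  add_mem' := by
    intro M N hM hN i j
    obtain ⟨a, ha⟩ := hM i j
    obtain ⟨b, hb⟩ := hN i j
    exact ⟨a + b, by rw [add_smul, ← ha, ← hb]; rfl⟩
  smul_mem' := by
    intro c M hM i j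
    obtain ⟨a, ha⟩ := hM i j
    exact ⟨c * a, by rw [mul_smul, ← ha]; rfl⟩

end Chi

/-! ### Linear generators -/

section Category

/-- A Krull-Schmidt category: every object is a finite direct sum of objects with local
endomorphism rings. -/
def KrullSchmidt (C : Type u) [Category.{v} C] [Preadditive C] [HasFiniteBiproducts C] : Prop :=
  ∀ X : C, ∃ (n : ℕ) (Y : Fin n → C), (∀ i, IsLocalRing (End (Y i))) ∧
    Nonempty (X ≅ biproduct Y)

/-- The relation `Q ≤ P`, meaning that `Hom(P, Q) ≅ k`. -/
def LinLE (k : Type w) [Field k] {C : Type u} [Category.{v} C] [Preadditive C] [Linear k C]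
    (Q P : C) : Prop :=
  Nonempty ((P ⟶ Q) ≃ₗ[k] k)

/-- The relation `Q < P`, meaning that `Q ≤ P` and `Q` is not isomorphic to `P`. -/
def LinLT (k : Type w) [Field k] {C : Type u} [Category.{v} C] [Preadditive C] [Linear k C]
    (Q P : C) : Prop :=
  LinLE k Q P ∧ ¬ Nonempty (Q ≅ P)

variable (k : Type w) [Field k] {C : Type u} [Category.{v} C] [Preadditive C] [Linear k C]
  [HasZeroObject C] [HasShift C ℤ] [∀ n : ℤ, (shiftFunctor C n).Additive] [Pretriangulated C]

/-- `⟨G⟩₁`: the smallest full additive subcategory containing `G` and closed under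
shifts and direct summands. -/
def addClosure (G : C) : ObjectProperty C :=
  ((ObjectProperty.singleton G).shiftClosure ℤ).binaryProductsClosure.retractClosure

/-- `P` is an indecomposable object of `⟨G⟩₁`. -/
def IsInd (G P : C) : Prop := Indecomposable P ∧ addClosure G P

/-- `G` is a classical generator: its thick closure is everything. -/
def IsClassicalGenerator (G : C) : Prop :=
  (ObjectProperty.singleton G).IsClassicalTriangulatedGenerator

/-- Linear generators. The first five conditions after `generates` say that `≤` induces a total
order on the isomorphism classes of indecomposable objects of `⟨G⟩₁`, for which there are no
nonzero morphisms from a smaller object to a strictly larger one. -/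
structure IsLinearGenerator (G : C) : Prop where
  generates : IsClassicalGenerator G
  refl : ∀ P, IsInd G P → LinLE k P P
  antisymm : ∀ P Q, IsInd G P → IsInd G Q → LinLE k P Q → LinLE k Q P → Nonempty (P ≅ Q)
  trans : ∀ P Q R, IsInd G P → IsInd G Q → IsInd G R → LinLE k P Q → LinLE k Q R → LinLE k P R
  total : ∀ P Q, IsInd G P → IsInd G Q → LinLE k P Q ∨ LinLE k Q P
  hom_eq_zero : ∀ P Q, IsInd G P → IsInd G Q → LinLT k Q P → ∀ f : Q ⟶ P, f = 0
  le_shift : ∀ P, IsInd G P → LinLE k P (P⟦(1 : ℤ)⟧)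
  between : ∀ P Q, IsInd G P → IsInd G Q → LinLE k P Q → LinLE k Q (P⟦(1 : ℤ)⟧) →
    Nonempty (Q ≅ P) ∨ Nonempty (Q ≅ P⟦(1 : ℤ)⟧)
  factors : ∀ P Q R, IsInd G P → IsInd G Q → IsInd G R → LinLE k R Q → LinLE k Q P →
    ∀ f : P ⟶ R, f ≠ 0 → ∃ (g : P ⟶ Q) (h : Q ⟶ R), g ≠ 0 ∧ h ≠ 0 ∧ g ≫ h = f

/-- `G` is a minimal generator: no proper direct summand of `G` is a generator. -/
def IsMinimalGenerator (G : C) : Prop :=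
  IsClassicalGenerator G ∧
    ∀ H H' : C, Nonempty (G ≅ H ⊞ H') → ¬ IsZero H' → ¬ IsClassicalGenerator H

end Category

end LinGen

end

namespace LinGen

/-! ### Isomorphism invariance of `LinLE`, shifts, and indecomposable objects -/

section Category

variable {k : Type w} [Field k] {C : Type u} [Category.{v} C] [Preadditive C] [Linear k C]

/-! Between indecomposables of `⟨G⟩₁` every Hom space is zero or a line, since a nonzero map `P ⟶ Q`
forces `Q ≤ P`. By the factorisation axiom, composites of nonzero maps are nonzero (`comp_ne_zero`).
So the algebra is determined by which spaces vanish and by the scalars appearing in products of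
chosen basis vectors.

Vanishing. Minimality makes distinct summands non-isomorphic even up to shift
(`not_iso_shift_of_minimal`). If `P ≤ Q` are such summands, `Q` cannot lie between `P⟦n⟧` and `P⟦n +
1⟧`, so every shift of `P` lies below `Q` (`linLE_shift_of_linLE`). This gives lines in all degrees
above the diagonal and zero below it. On the diagonal, `P ≤ P⟦1⟧` gives lines in degrees `≤ 0`.
Positive degrees give zero if `P < P⟦1⟧`, and lines if `P ≅ P⟦1⟧`.

Scalars. Let `o` be the least summand, `x` a nonzero endomorphism of `o` of degree `-1`, and `y i`
nonzero of degree `0` from the `i`-th summand to `o`. A morphism `f` of degree `n` from the `j`-th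
to the `i`-th summand gets the coordinate `c` for which `f`, followed by `y i` and `x ^ N`, equals
`c` times `y j` followed by `x ^ M`, where `M = N - n`. All comparisons take place in lines over one
object, so the coordinates are multiplicative (`exists_multiplicative_coordinates`). Sending `f` to
`c * x ^ (-n)` in position `(i, j)` is then the required isomorphism. -/

theorem LinLE.of_iso {Q Q' P P' : C} (h : LinLE k Q P) (e : Q ≅ Q') (e' : P ≅ P') :
    LinLE k Q' P' :=
  h.map fun l => (Linear.homCongr k e' e).symm.trans l

theorem LinLE.exists_ne_zero {Q P : C} (h : LinLE k Q P) : ∃ f : P ⟶ Q, f ≠ 0 := by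
  obtain ⟨l⟩ := h
  exact ⟨l.symm 1, by simp⟩

theorem LinLE.exists_smul {Q P : C} (h : LinLE k Q P) {f : P ⟶ Q} (hf : f ≠ 0) (g : P ⟶ Q) :
    ∃ c : k, g = c • f := by
  obtain ⟨l⟩ := h
  have hl : l f ≠ 0 := by simpa using hf
  exact ⟨l g / l f, l.injective (by simp [hl])⟩

variable [HasShift C ℤ] [∀ n : ℤ, (shiftFunctor C n).Additive]

/-- Shifting is a linear isomorphism on morphisms. -/
noncomputable def shiftHomEquiv (k : Type w) [Field k] [Linear k C]
    [∀ n : ℤ, (shiftFunctor C n).Linear k] (P Q : C) (n : ℤ) :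
    (P ⟶ Q) ≃ₗ[k] (P⟦n⟧ ⟶ Q⟦n⟧) :=
  LinearEquiv.ofBijective ((shiftFunctor C n).mapLinearMap k)
    ⟨(shiftFunctor C n).map_injective, (shiftFunctor C n).map_surjective⟩

theorem linLE_shift_iff [∀ n : ℤ, (shiftFunctor C n).Linear k] {P Q : C} (n : ℤ) :
    LinLE k (Q⟦n⟧) (P⟦n⟧) ↔ LinLE k Q P :=
  ⟨fun h => h.map fun l => (shiftHomEquiv k P Q n).trans l,
    fun h => h.map fun l => (shiftHomEquiv k P Q n).symm.trans l⟩

theorem isZero_of_isZero_shift {X : C} {n : ℤ} (h : IsZero (X⟦n⟧)) : IsZero X :=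
  (((shiftFunctor C (-n)).map_isZero h)).of_iso
    ((shiftFunctorCompIsoId C n (-n) (by simp)).app X).symm

theorem indecomposable_shift [HasBinaryBiproducts C] {P : C} (h : Indecomposable P) (n : ℤ) :
    Indecomposable (P⟦n⟧) := by
  refine ⟨fun hz => h.1 (isZero_of_isZero_shift hz), fun Y Z e => ?_⟩
  have := preservesBinaryBiproducts_of_preservesBiproducts (shiftFunctor C (-n))
  have e' : P ≅ Y⟦-n⟧ ⊞ Z⟦-n⟧ :=
    ((shiftFunctorCompIsoId C n (-n) (by simp)).app P).symm ≪≫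
      (shiftFunctor C (-n)).mapIso e ≪≫ (shiftFunctor C (-n)).mapBiprod Y Z
  exact (h.2 _ _ e').imp isZero_of_isZero_shift isZero_of_isZero_shift

variable [HasZeroObject C] [Pretriangulated C]

/-- For a retract `P` of `G`, the object `P⟦n⟧` is a retract of `G⟦n⟧`, which already lies in the
shift closure. Stability of all of `⟨G⟩₁` under shifts is therefore not needed. -/
theorem IsInd.shift {G P : C} (h : IsInd G P) (n : ℤ)
    (hP : Nonempty (Retract P G)) : IsInd G (P⟦n⟧) := by
  obtain ⟨r⟩ := hP
  refine ⟨indecomposable_shift h.1 n, G⟦n⟧, ?_, ⟨r.map (shiftFunctor C n)⟩⟩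
  exact ObjectProperty.le_limitsClosure _ _ _ ⟨G, n, Iso.refl _, by simp⟩

theorem IsInd.of_retract {G P : C} (h : Indecomposable P) (r : Retract P G) : IsInd G P :=
  ⟨h, G, ObjectProperty.le_limitsClosure _ _ _ (ObjectProperty.le_shiftClosure _ _ (by simp)), ⟨r⟩⟩

end Category

/-! ### Minimality separates the summands up to shift -/

section Minimal

variable {C : Type u} [Category.{v} C] [Preadditive C] [HasZeroObject C] [HasShift C ℤ]
  [∀ n : ℤ, (shiftFunctor C n).Additive] [Pretriangulated C]

/-- A biproduct splits off any one of its factors. -/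
noncomputable def biproductSplit [HasFiniteBiproducts C] {m : ℕ} (H : Fin m → C) (j : Fin m) :
    biproduct H ≅ biproduct (Subtype.restrict (fun i => i ≠ j) H) ⊞ H j where
  hom := biprod.lift (biproduct.toSubtype H fun i => i ≠ j) (biproduct.π H j)
  inv := biprod.desc (biproduct.fromSubtype H fun i => i ≠ j) (biproduct.ι H j)
  hom_inv_id := by
    rw [biprod.lift_desc, biproduct.toSubtype_fromSubtype]
    refine biproduct.hom_ext' _ _ fun i => biproduct.hom_ext _ _ fun l => ?_
    by_cases hi : i = j
    · subst hi
      simp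
    · simp [biproduct.ι_π_ne_assoc H hi, hi]
  inv_hom_id := by
    apply biprod.hom_ext' <;> apply biprod.hom_ext
    · simp
    · ext i
      simp
    · simp
    · simp

/-- Otherwise the `j`-th summand is redundant: the complement of `H j` still contains `H i`, hence
generates `H j` by shifting back, and so generates `G`. -/
theorem not_iso_shift_of_minimal [IsTriangulated C] {G : C} (minimal : IsMinimalGenerator G)
    {m : ℕ} {H : Fin m → C} (indecomposable : ∀ i, Indecomposable (H i))
    (e : G ≅ biproduct H) {i j : Fin m} (hij : i ≠ j) (n : ℤ) :
    ¬ Nonempty (H i ≅ (H j)⟦n⟧) := by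
  rintro ⟨e'⟩
  refine minimal.2 _ _ ⟨e ≪≫ biproductSplit H j⟩ (indecomposable j).1 ?_
  set H' := biproduct (Subtype.restrict (fun i => i ≠ j) H)
  let E := (ObjectProperty.singleton H').triangEnvelope
  have h1 : E H' := ObjectProperty.le_triangEnvelope _ _ (by simp)
  have h2 : E (H i) := ObjectProperty.IsStableUnderRetracts.of_biproduct _
    (Subtype.restrict (fun i => i ≠ j) H) h1 ⟨i, hij⟩
  have h3 : E (H j) := by
    have := E.le_shift (-n) _ h2
    exact E.prop_of_iso ((shiftFunctor C (-n)).mapIso e' ≪≫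
      (shiftFunctorCompIsoId C n (-n) (by simp)).app (H j)) this
  -- `G` is an extension of `H j` by its complement, through the split triangle.
  have h4 : E G := E.prop_of_iso (e ≪≫ biproductSplit H j).symm
    (E.ext_of_isTriangulatedClosed₂ _ (Pretriangulated.binaryBiproductTriangle_distinguished _ _) h1 h3)
  refine eq_top_iff.2 ?_
  rw [← (show _ = ⊤ from minimal.1), ObjectProperty.triangEnvelope_le_iff]
  simpa using h4

end Minimal
end LinGen

namespace LinGen

/-! ### Morphisms between shifts of indecomposables -/

section LinearGenerator

variable {k : Type w} [Field k] {C : Type u} [Category.{v} C] [Preadditive C] [Linear k C]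
  [HasZeroObject C] [HasShift C ℤ] [∀ n : ℤ, (shiftFunctor C n).Additive] [Pretriangulated C]
  {G : C}

namespace IsLinearGenerator

theorem linLE_of_ne_zero (lin : IsLinearGenerator k G) {P Q : C} (hP : IsInd G P)
    (hQ : IsInd G Q) {f : P ⟶ Q} (hf : f ≠ 0) : LinLE k Q P := by
  rcases lin.total Q P hQ hP with h | h
  · exact h
  · by_cases e : Nonempty (P ≅ Q)
    · obtain ⟨e⟩ := e
      exact (lin.refl P hP).of_iso e (Iso.refl P)
    · exact absurd (lin.hom_eq_zero Q P hQ hP ⟨h, e⟩ f) hf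

/-- Some nonzero `t : P ⟶ R` exists by transitivity, and it factors through `Q`. Its two factors lie
in the lines spanned by `f` and `g`, so `t` is a multiple of `f ≫ g`. -/
theorem comp_ne_zero (lin : IsLinearGenerator k G) {P Q R : C} (hP : IsInd G P)
    (hQ : IsInd G Q) (hR : IsInd G R) {f : P ⟶ Q} {g : Q ⟶ R} (hf : f ≠ 0) (hg : g ≠ 0) :
    f ≫ g ≠ 0 := by
  have hQP := lin.linLE_of_ne_zero hP hQ hf
  have hRQ := lin.linLE_of_ne_zero hQ hR hg
  obtain ⟨t, ht⟩ := (lin.trans R Q P hR hQ hP hRQ hQP).exists_ne_zero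
  obtain ⟨f', g', -, -, h⟩ := lin.factors P Q R hP hQ hR hRQ hQP t ht
  obtain ⟨c, rfl⟩ := hQP.exists_smul hf f'
  obtain ⟨d, rfl⟩ := hRQ.exists_smul hg g'
  intro h0
  exact ht (by rw [← h]; simp [h0])

theorem linLE_shift_of_le (lin : IsLinearGenerator k G) {P : C} (hP : ∀ n : ℤ, IsInd G (P⟦n⟧))
    {a b : ℤ} (hab : a ≤ b) : LinLE k (P⟦a⟧) (P⟦b⟧) := by
  induction b, hab using Int.leInduction with
  | base => exact lin.refl _ (hP a)
  | succ b hb ih =>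
    exact lin.trans _ _ _ (hP _) (hP _) (hP _) ih
      ((lin.le_shift _ (hP b)).of_iso (Iso.refl _) ((shiftFunctorAdd C b 1).app P).symm)

/-- The object `P⟦0⟧` is isomorphic to `P`. -/
noncomputable def _root_.LinGen.shiftZeroIso (P : C) : P⟦(0 : ℤ)⟧ ≅ P :=
  (shiftFunctorZero C ℤ).app P

theorem linLE_shift_nonpos (lin : IsLinearGenerator k G) {P : C}
    (hP : ∀ n : ℤ, IsInd G (P⟦n⟧)) {n : ℤ} (hn : n ≤ 0) : LinLE k (P⟦n⟧) P :=
  (lin.linLE_shift_of_le hP hn).of_iso (Iso.refl _) (shiftZeroIso P)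

/-- Since `P ≤ P⟦1⟧` always holds, failure of strictness means `P ≅ P⟦1⟧`; positive shifts then
follow by shifting `P⟦n⟧ ≤ P` once more. -/
theorem linLE_shift_of_not_linLT [∀ n : ℤ, (shiftFunctor C n).Linear k]
    (lin : IsLinearGenerator k G) {P : C} (h : IsInd G P)
    (hP : ∀ n : ℤ, IsInd G (P⟦n⟧)) (hlt : ¬ LinLT k P (P⟦(1 : ℤ)⟧)) (n : ℤ) :
    LinLE k (P⟦n⟧) P := by
  have e : Nonempty (P ≅ P⟦(1 : ℤ)⟧) := by
    by_contra he
    exact hlt ⟨lin.le_shift P h, he⟩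
  obtain ⟨e⟩ := e
  rcases le_total n 0 with hn | hn
  · exact lin.linLE_shift_nonpos hP hn
  · induction n, hn using Int.leInduction with
    | base => exact lin.linLE_shift_nonpos hP le_rfl
    | succ n hn ih =>
      exact ((linLE_shift_iff (1 : ℤ)).2 ih).of_iso ((shiftFunctorAdd C n 1).app P).symm e.symm

/-- `P < P⟦1⟧ ≤ P⟦n⟧`, and strictness survives: `P ≅ P⟦n⟧` would give `P⟦1⟧ ≤ P`, hence `P ≅ P⟦1⟧`
by antisymmetry. -/
theorem hom_shift_eq_zero_of_linLT (lin : IsLinearGenerator k G) {P : C} (h : IsInd G P)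
    (hP : ∀ n : ℤ, IsInd G (P⟦n⟧)) (hlt : LinLT k P (P⟦(1 : ℤ)⟧)) {n : ℤ} (hn : 0 < n)
    (f : P ⟶ P⟦n⟧) : f = 0 := by
  have hle : LinLE k (P⟦(1 : ℤ)⟧) (P⟦n⟧) := lin.linLE_shift_of_le hP (by omega)
  refine lin.hom_eq_zero _ _ (hP n) h ⟨lin.trans _ _ _ h (hP 1) (hP n) hlt.1 hle, ?_⟩ f
  rintro ⟨e⟩
  exact hlt.2 (lin.antisymm _ _ h (hP 1) hlt.1 (hle.of_iso (Iso.refl _) e.symm))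

/-- Negative shifts follow by transitivity. Upwards, if `P⟦n⟧ ≤ Q` but not `P⟦n + 1⟧ ≤ Q`, totality
traps `Q` between consecutive shifts of `P`, and the axiom `between` makes it isomorphic to one of
them. -/
theorem linLE_shift_of_linLE (lin : IsLinearGenerator k G) {P Q : C} (hQ : IsInd G Q)
    (hP : ∀ n : ℤ, IsInd G (P⟦n⟧)) (hPQ : ∀ n : ℤ, ¬ Nonempty (Q ≅ P⟦n⟧)) (hle : LinLE k P Q)
    (n : ℤ) : LinLE k (P⟦n⟧) Q := by
  have h0 : LinLE k (P⟦(0 : ℤ)⟧) Q := hle.of_iso (shiftZeroIso P).symm (Iso.refl _)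
  rcases le_total n 0 with hn | hn
  · exact lin.trans _ _ _ (hP _) (hP _) hQ (lin.linLE_shift_of_le hP hn) h0
  · induction n, hn using Int.leInduction with
    | base => exact h0
    | succ n hn ih =>
      rcases lin.total _ _ (hP (n + 1)) hQ with h | h
      · exact h
      · have e := (shiftFunctorAdd C n 1).app P
        rcases lin.between _ _ (hP n) hQ ih (h.of_iso (Iso.refl _) e) with h' | ⟨⟨e'⟩⟩
        · exact absurd h' (hPQ n)
        · exact absurd ⟨e' ≪≫ e.symm⟩ (hPQ (n + 1))

theorem hom_shift_eq_zero_of_linLE (lin : IsLinearGenerator k G) {P Q : C} (hQ : IsInd G Q)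
    (hP : ∀ n : ℤ, IsInd G (P⟦n⟧)) (hPQ : ∀ n : ℤ, ¬ Nonempty (Q ≅ P⟦n⟧)) (hle : LinLE k P Q)
    (n : ℤ) (f : P ⟶ Q⟦n⟧) : f = 0 := by
  let e := (shiftFunctorCompIsoId C n (-n) (by simp)).app Q
  -- Shifted by `-n`, the map goes from `P⟦-n⟧` to `Q`, that is, from a smaller object to a strictly
  -- larger one.
  have h : f⟦-n⟧' ≫ e.hom = 0 := lin.hom_eq_zero _ _ hQ (hP (-n))
    ⟨lin.linLE_shift_of_linLE hQ hP hPQ hle (-n), fun ⟨e⟩ => hPQ _ ⟨e.symm⟩⟩ _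
  refine (shiftFunctor C (-n)).map_injective ?_
  rw [Functor.map_zero]
  exact (cancel_mono e.hom).1 (h.trans zero_comp.symm)

theorem shiftedHom_comp_ne_zero (lin : IsLinearGenerator k G) {P Q R : C} (hP : IsInd G P)
    (hQ : ∀ n : ℤ, IsInd G (Q⟦n⟧)) (hR : ∀ n : ℤ, IsInd G (R⟦n⟧)) {a b c : ℤ}
    {f : ShiftedHom P Q a} {g : ShiftedHom Q R b} (hf : f ≠ 0) (hg : g ≠ 0) (h : b + a = c) :
    f.comp g h ≠ 0 := by
  refine lin.comp_ne_zero hP (hQ a) (hR c) hf fun h0 => hg ?_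
  refine (shiftFunctor C a).map_injective ?_
  rw [Functor.map_zero]
  exact (cancel_mono ((shiftFunctorAdd' C b a c h).inv.app R)).1 (h0.trans zero_comp.symm)

end IsLinearGenerator

end LinearGenerator

/-- Sorting the indices. Only a total preorder is required; strictness for the summands comes later
from their being pairwise non-isomorphic. -/
theorem exists_perm_of_total {m : ℕ} (r : Fin m → Fin m → Prop) (total : ∀ i j, r i j ∨ r j i)
    (trans : ∀ i j l, r i j → r j l → r i l) :
    ∃ σ : Equiv.Perm (Fin m), ∀ i j, i < j → r (σ i) (σ j) := by
  classical
  let l := (List.finRange m).mergeSort (fun i j => decide (r i j))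
  have hs : l.Pairwise r := by
    have := List.pairwise_mergeSort (le := fun i j => decide (r i j))
      (fun a b c => by simpa using trans a b c) (fun a b => by simpa using total a b)
      (List.finRange m)
    simpa using this
  have hp : l.Perm (List.finRange m) := List.mergeSort_perm _ _
  have hlen : l.length = m := by simpa using hp.length_eq
  have hnd : l.Nodup := hp.nodup_iff.2 (List.nodup_finRange m)
  let f : Fin m → Fin m := fun i => l.get (i.cast hlen.symm)
  have hf : Function.Injective f := fun i j h => by
    simpa using (List.nodup_iff_injective_get.1 hnd) h
  refine ⟨Equiv.ofBijective f (Finite.injective_iff_bijective.1 hf), fun i j hij => ?_⟩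
  exact List.pairwise_iff_get.1 hs _ _ (by simpa using hij)

end LinGen

namespace LinGen

/-! ### Multiplicative coordinates on graded morphism spaces -/

section Coordinates

variable {C : Type u} [Category.{v} C] [HasShift C ℤ]

/-- The `N`-th power of an endomorphism of degree `-1`, in degree `n = -N`. -/
noncomputable def shiftedPow {X : C} (x : ShiftedHom X X (-1 : ℤ)) :
    (N : ℕ) → (n : ℤ) → (hn : n = -N) → ShiftedHom X X n
  | 0, n, hn => ShiftedHom.mk₀ n (by simpa using hn) (𝟙 X)
  | N + 1, n, hn => (shiftedPow x N (n + 1) (by push_cast at hn; omega)).comp x (by ring)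

theorem shiftedPow_comp {X : C} (x : ShiftedHom X X (-1 : ℤ)) (a b : ℕ) {a' b' c : ℤ}
    (ha : a' = -a) (hb : b' = -b) (h : b' + a' = c) :
    (shiftedPow x a a' ha).comp (shiftedPow x b b' hb) h =
      shiftedPow x (a + b) c (by push_cast; omega) := by
  induction b generalizing b' c with
  | zero =>
    obtain rfl : b' = 0 := by simpa using hb
    obtain rfl : c = a' := by omega
    exact ShiftedHom.comp_mk₀_id _ _ _
  | succ b ih =>
    have h' := ih (b' := b' + 1) (c := c + 1) (by push_cast at hb; omega) (by omega)
    refine (ShiftedHom.comp_assoc _ _ _ (show _ = c + 1 by omega) (show _ = b' by ring)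
      (by omega)).symm.trans ?_
    rw [h']
    rfl

variable [Preadditive C]
  {k : Type w} [Field k] [Linear k C]

theorem exists_coordinate_of_ne_zero {V : Type*} [AddCommGroup V] [Module k V] {B : V}
    (hB : B ≠ 0) (h : ∀ v : V, ∃ c : k, v = c • B) : ∃ l : V →ₗ[k] k, ∀ v, v = l v • B := by
  let e : k ≃ₗ[k] V := LinearEquiv.ofBijective (LinearMap.toSpanSingleton k V B)
    ⟨fun a b hab => smul_left_injective k hB hab, fun v => (h v).imp fun c hc => hc.symm⟩
  exact ⟨e.symm.toLinearMap, fun v => (e.apply_symm_apply v).symm⟩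

variable [∀ n : ℤ, (shiftFunctor C n).Linear k]

/-- If the graded morphism spaces between the objects `P i` are at most one-dimensional, if
nonzero morphisms have nonzero composites, and if every `P i` maps to a fixed object carrying a
nonzero endomorphism of degree `-1`, then coordinates on these spaces can be chosen
multiplicatively. -/
theorem exists_multiplicative_coordinates {ι : Type*} (P : ι → C) (o : ι)
    (one_dim : ∀ i j (n : ℤ) (f g : ShiftedHom (P j) (P i) n), f ≠ 0 → ∃ c : k, g = c • f)
    (comp_ne_zero : ∀ i l j (a b c : ℤ) (h : a + b = c) (f : ShiftedHom (P j) (P l) b)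
      (g : ShiftedHom (P l) (P i) a), f ≠ 0 → g ≠ 0 → f.comp g h ≠ 0)
    (x : ShiftedHom (P o) (P o) (-1 : ℤ)) (hx : x ≠ 0)
    (y : ∀ i, ShiftedHom (P i) (P o) (0 : ℤ)) (hy : ∀ i, y i ≠ 0) :
    ∃ l : ∀ i j (n : ℤ), ShiftedHom (P j) (P i) n →ₗ[k] k,
      (∀ i j n f, l i j n f = 0 → f = 0) ∧
      (∀ i, l i i 0 (ShiftedHom.mk₀ 0 rfl (𝟙 (P i))) = 1) ∧
      ∀ i p j (a b c : ℤ) (h : a + b = c) (f : ShiftedHom (P j) (P p) b)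
        (g : ShiftedHom (P p) (P i) a), l i j c (f.comp g h) = l i p a g * l p j b f := by
  have id_ne : 𝟙 (P o) ≠ 0 := fun h => hx (by rw [← Category.id_comp x, h, zero_comp])
  have pow_ne : ∀ (N : ℕ) (n : ℤ) (hn : n = -N), shiftedPow x N n hn ≠ 0 := by
    intro N
    induction N with
    | zero =>
      intro n hn h
      refine id_ne ((ShiftedHom.homEquiv n (by simpa using hn)).injective ?_)
      rw [ShiftedHom.homEquiv_apply, ShiftedHom.homEquiv_apply, ShiftedHom.mk₀_zero]
      exact h
    | succ N ih => exact fun n hn => comp_ne_zero _ _ _ _ _ _ _ _ _ (ih _ _) hx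
  have base_ne : ∀ j (M : ℕ) (d : ℤ) (hM : d = -M),
      (y j).comp (shiftedPow x M d hM) (add_zero d) ≠ 0 := fun j M d hM =>
    comp_ne_zero _ _ _ _ _ _ _ _ _ (hy j) (pow_ne _ _ _)
  -- The exponents `n.toNat` and `(-n).toNat` are the smallest natural numbers `N`, `M` with `M = N
  -- - n`. Since `x` need not be invertible, its powers are put on both sides instead of using `x ^
  -- (-n)`.
  have key : ∀ i j (n : ℤ), ∃ l : ShiftedHom (P j) (P i) n →ₗ[k] k, ∀ f,
      (f.comp (y i) (zero_add n)).comp (shiftedPow x n.toNat (-n.toNat) rfl)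
        (show _ = (-(-n).toNat : ℤ) by omega) =
      l f • (y j).comp (shiftedPow x (-n).toNat _ rfl) (add_zero _) := by
    intro i j n
    obtain ⟨l, hl⟩ := exists_coordinate_of_ne_zero (k := k) (base_ne j (-n).toNat _ rfl)
      fun v => one_dim _ _ _ _ v (base_ne j (-n).toNat _ rfl)
    refine ⟨l ∘ₗ
      { toFun := fun f => (f.comp (y i) (zero_add n)).comp
          (shiftedPow x n.toNat (-n.toNat) rfl) (show _ = (-(-n).toNat : ℤ) by omega)
        map_add' := by simp
        map_smul' := by simp }, fun f => hl _⟩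
  choose l hl using key
  -- The same coordinate works for all admissible exponents: these exceed the smallest ones by a
  -- common `r`, so both sides of `key` are composed with `x ^ r`.
  have gen : ∀ i j (n : ℤ) (f : ShiftedHom (P j) (P i) n) (N M : ℕ) (d e : ℤ) (hd : d = -N)
      (he : e = -M) (h : d + n = e),
      (f.comp (y i) (zero_add n)).comp (shiftedPow x N d hd) h =
        l i j n f • (y j).comp (shiftedPow x M e he) (add_zero e) := by
    intro i j n f N M d e hd he h
    obtain ⟨r, rfl⟩ : ∃ r, N = n.toNat + r := ⟨N - n.toNat, by omega⟩
    obtain rfl : M = (-n).toNat + r := by omega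
    rw [← shiftedPow_comp x n.toNat r rfl rfl (by push_cast at hd; omega),
      ← shiftedPow_comp x (-n).toNat r rfl rfl (by push_cast at he; omega),
      ← ShiftedHom.comp_assoc _ _ _ (show _ = (-(-n).toNat : ℤ) by omega) _
        (by push_cast at hd; omega), hl,
      ShiftedHom.smul_comp, ShiftedHom.comp_assoc]
    omega
  have uniq : ∀ j (M : ℕ) (d : ℤ) (hM : d = -M) (s t : k),
      s • (y j).comp (shiftedPow x M d hM) (add_zero d) =
        t • (y j).comp (shiftedPow x M d hM) (add_zero d) → s = t := fun j M d hM s t h =>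
    smul_left_injective k (base_ne j M d hM) h
  refine ⟨l, fun i j n f h => ?_, fun i => ?_, fun i p j a b c h f g => ?_⟩
  · by_contra hf
    refine comp_ne_zero _ _ _ _ _ _ _ _ _ (comp_ne_zero _ _ _ _ _ _ _ _ _ hf (hy i))
      (pow_ne _ _ _) ((hl i j n f).trans ?_)
    rw [h, zero_smul]
  · refine uniq i 0 0 (by simp) _ _ ?_
    rw [← gen i i 0 _ 0 0 0 0 (by simp) (by simp) (by simp), ShiftedHom.mk₀_id_comp, one_smul]
  · have hg := gen i p a g a.toNat (-a).toNat _ _ rfl rfl (by omega)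
    have hf := gen p j b f b.toNat (-b).toNat _ _ rfl rfl (by omega)
    -- The exponent `a.toNat + b.toNat` may exceed `c.toNat`, which is why `gen` is needed for the
    -- composite. First `hg` extracts the coordinate of `g` and replaces `y i` by `y p`; then `hf`
    -- extracts that of `f`.
    refine uniq j ((-a).toNat + (-b).toNat) _ rfl _ _ ?_
    rw [← gen i j c _ (a.toNat + b.toNat) _ _ _ rfl rfl (by push_cast; omega)]
    rw [← shiftedPow_comp x a.toNat b.toNat rfl rfl (by push_cast; omega),
      ShiftedHom.comp_assoc f g (y i) h (zero_add a) (by omega),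
      ← ShiftedHom.comp_assoc _ _ _ (show _ = (-(-a).toNat : ℤ) + b by omega) _ (by omega),
      ShiftedHom.comp_assoc f _ _ (zero_add a ▸ by omega) (show _ = (-(-a).toNat : ℤ) by omega)
        (by omega), hg, ShiftedHom.comp_smul, ShiftedHom.smul_comp,
      ← ShiftedHom.comp_assoc f _ _ (zero_add b) _ (by omega),
      ShiftedHom.comp_assoc _ _ _ _ rfl (by omega), shiftedPow_comp]
    -- Powers of `x` commute; this brings `x ^ b.toNat` next to `y p`, where `hf` applies.
    have swap : shiftedPow x ((-a).toNat + b.toNat) (-b.toNat + -(-a).toNat) (by push_cast; omega) =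
        (shiftedPow x b.toNat _ rfl).comp (shiftedPow x (-a).toNat _ rfl) (by ring) := by
      rw [shiftedPow_comp]
      congr 1
      omega
    rw [swap, ← ShiftedHom.comp_assoc _ _ _ (show _ = (-(-b).toNat : ℤ) by omega) _ (by omega), hf,
      ShiftedHom.smul_comp, ShiftedHom.comp_assoc _ _ _ _
        (show _ = (-((-a).toNat + (-b).toNat : ℕ) : ℤ) by push_cast; omega) (by omega),
      shiftedPow_comp, smul_smul]
    congr 3
    omega

end Coordinates
end LinGen

namespace LinGen

/-! ### From coordinates to the triangular matrix algebra -/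

section MatrixAlgebra

open LaurentPolynomial

variable {C : Type u} [Category.{v} C] [HasShift C ℤ] [Preadditive C] {m : ℕ}

/-- A presentation of `G` as the direct sum of the objects `H i`. -/
structure Splitting (G : C) (H : Fin m → C) where
  /-- The inclusions of the summands. -/
  inc : ∀ i, H i ⟶ G
  /-- The projections to the summands. -/
  proj : ∀ i, G ⟶ H i
  inc_proj_self : ∀ i, inc i ≫ proj i = 𝟙 (H i)
  inc_proj_ne : ∀ i j, i ≠ j → inc i ≫ proj j = 0
  total : ∑ i, proj i ≫ inc i = 𝟙 G

/-- The splitting of an object isomorphic to a biproduct, with its summands permuted. -/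
noncomputable def Splitting.ofIso [HasFiniteBiproducts C] {G : C} {H : Fin m → C}
    (e : G ≅ biproduct H) (σ : Equiv.Perm (Fin m)) : Splitting G (fun i => H (σ i)) where
  inc i := biproduct.ι H (σ i) ≫ e.inv
  proj i := e.hom ≫ biproduct.π H (σ i)
  inc_proj_self i := by simp
  inc_proj_ne i j hij := by
    simp [biproduct.ι_π_ne H (show σ i ≠ σ j from fun h => hij (σ.injective h))]
  total := by
    rw [Equiv.sum_comp σ fun i => (e.hom ≫ biproduct.π H i) ≫ biproduct.ι H i ≫ e.inv]
    have h : ∀ i, (e.hom ≫ biproduct.π H i) ≫ biproduct.ι H i ≫ e.inv =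
        e.hom ≫ (biproduct.π H i ≫ biproduct.ι H i) ≫ e.inv := fun i => by simp
    simp_rw [h]
    rw [← Preadditive.comp_sum, ← Preadditive.sum_comp, biproduct.total]
    simp

variable (k : Type w) [Field k] [Linear k C]

/-- Multiplicative coordinates on the graded morphism spaces between the objects `P i`. -/
structure Coordinates {ι : Type*} (P : ι → C) where
  /-- The coordinate of a morphism. -/
  coord : ∀ i j (n : ℤ), ShiftedHom (P j) (P i) n →ₗ[k] k
  eq_zero : ∀ i j n f, coord i j n f = 0 → f = 0
  one : ∀ i, coord i i 0 (ShiftedHom.mk₀ 0 rfl (𝟙 (P i))) = 1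
  mul : ∀ i p j (a b c : ℤ) (h : a + b = c) (f : ShiftedHom (P j) (P p) b)
    (g : ShiftedHom (P p) (P i) a), coord i j c (f.comp g h) = coord i p a g * coord p j b f

variable {G : C} {H : Fin m → C} (s : Splitting G H)

/-- The matrix entries of a morphism `G ⟶ G⟦n⟧`. -/
noncomputable def Splitting.entry (i j : Fin m) (n : ℤ) :
    ShiftedHom G G n →ₗ[k] ShiftedHom (H j) (H i) n :=
  Linear.leftComp k _ (s.inc j) ∘ₗ Linear.rightComp k _ ((s.proj i)⟦n⟧')

theorem Splitting.entry_apply (i j : Fin m) (n : ℤ) (f : ShiftedHom G G n) :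
    s.entry k i j n f = s.inc j ≫ f ≫ (s.proj i)⟦n⟧' :=
  rfl

theorem Splitting.entry_one (i j : Fin m) :
    s.entry k i j 0 (ShiftedHom.mk₀ 0 rfl (𝟙 G)) =
      ShiftedHom.mk₀ 0 rfl (s.inc j ≫ s.proj i) := by
  have nat := (shiftFunctorZero' C (0 : ℤ) rfl).inv.naturality (s.proj i)
  rw [Functor.id_map] at nat
  simp [Splitting.entry_apply, ShiftedHom.mk₀, nat]

variable {k} (l : Coordinates k H)

/-- The matrix of a morphism `G ⟶ G⟦n⟧`. -/
noncomputable def homogeneousMatrix (n : ℤ) :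
    ShiftedHom G G n →ₗ[k] Matrix (Fin m) (Fin m) k[T;T⁻¹] where
  toFun f := Matrix.of fun i j => l.coord i j n (s.entry k i j n f) • T (-n)
  map_add' f g := by
    ext1 i j
    rw [Matrix.add_apply, Matrix.of_apply, _root_.map_add, _root_.map_add, add_smul]
    rfl
  map_smul' r f := by
    ext1 i j
    rw [Matrix.smul_apply, Matrix.of_apply, _root_.map_smul, _root_.map_smul, smul_eq_mul,
      mul_smul]
    rfl

theorem homogeneousMatrix_apply (n : ℤ) (f : ShiftedHom G G n) (i j : Fin m) :
    homogeneousMatrix s l n f i j = l.coord i j n (s.entry k i j n f) • T (-n) :=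
  rfl

/-- A morphism `G ⟶ G⟦n⟧` as an element of the graded endomorphism algebra. -/
def EndDeg.ofHom {n : ℤ} (f : ShiftedHom G G n) : EndDeg G n :=
  f

variable (k) in
/-- The matrix entries of an element of degree `n` of the graded endomorphism algebra. -/
noncomputable def Splitting.degEntry (i j : Fin m) (n : ℤ) :
    EndDeg G n →ₗ[k] ShiftedHom (H j) (H i) n :=
  s.entry k i j n

/-- The matrix of an element of degree `n` of the graded endomorphism algebra. -/
noncomputable def degreeMatrix (n : ℤ) : EndDeg G n →ₗ[k] Matrix (Fin m) (Fin m) k[T;T⁻¹] :=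
  homogeneousMatrix s l n

theorem degreeMatrix_apply (n : ℤ) (f : EndDeg G n) (i j : Fin m) :
    degreeMatrix s l n f i j = l.coord i j n (s.degEntry k i j n f) • T (-n) :=
  rfl

theorem homogeneousMatrix_one :
    homogeneousMatrix s l 0 (ShiftedHom.mk₀ 0 rfl (𝟙 G)) = 1 := by
  ext1 i j
  rw [homogeneousMatrix_apply, s.entry_one k, neg_zero, T_zero]
  by_cases h : i = j
  · subst h
    rw [s.inc_proj_self, l.one, one_smul, Matrix.one_apply_eq]
  · rw [s.inc_proj_ne _ _ (Ne.symm h), ShiftedHom.mk₀_zero, _root_.map_zero, zero_smul,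
      Matrix.one_apply_ne h]

variable [∀ n : ℤ, (shiftFunctor C n).Additive]

variable (k) in
-- Matrix multiplication: the identity of `G`, written as the sum of the `proj q ≫ inc q`, is
-- inserted between `f` and `g`.
theorem Splitting.entry_comp {n p : ℤ} (g : ShiftedHom G G n) (f : ShiftedHom G G p)
    (i j : Fin m) : s.entry k i j (n + p) (f.comp g rfl) =
      ∑ q, (s.entry k q j p f).comp (s.entry k i q n g) rfl := by
  have hq : ∀ q, (s.entry k q j p f).comp (s.entry k i q n g) rfl =
      (s.inc j ≫ f) ≫ ((s.proj q ≫ s.inc q)⟦p⟧' ≫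
        g⟦p⟧' ≫ (shiftFunctorAdd' C n p (n + p) rfl).inv.app G ≫ (s.proj i)⟦n + p⟧') := fun q => by
    have nat := (shiftFunctorAdd' C n p (n + p) rfl).inv.naturality (s.proj i)
    rw [Functor.comp_map] at nat
    simp [ShiftedHom.comp, Splitting.entry_apply, nat]
  simp_rw [hq]
  rw [← Preadditive.comp_sum, ← Preadditive.sum_comp, ← Functor.map_sum, s.total]
  simp [Splitting.entry_apply, ShiftedHom.comp]

variable (k) in
theorem Splitting.eq_zero_of_entry {n : ℤ} (f : ShiftedHom G G n)
    (h : ∀ i j, s.entry k i j n f = 0) : f = 0 := by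
  have h1 : ∀ i j, s.proj j ≫ s.entry k i j n f ≫ (s.inc i)⟦n⟧' =
      (s.proj j ≫ s.inc j) ≫ f ≫ (s.proj i ≫ s.inc i)⟦n⟧' := fun i j => by
    simp [Splitting.entry_apply]
  have hf : f = ∑ j, ∑ i, s.proj j ≫ s.entry k i j n f ≫ (s.inc i)⟦n⟧' := by
    simp_rw [h1, ← Preadditive.comp_sum, ← Functor.map_sum, s.total, ← Preadditive.sum_comp,
      s.total]
    simp
  rw [hf]
  simp [h]

theorem homogeneousMatrix_comp {a b : ℤ} (g : ShiftedHom G G a) (f : ShiftedHom G G b) :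
    homogeneousMatrix s l (a + b) (f.comp g rfl) =
      homogeneousMatrix s l a g * homogeneousMatrix s l b f := by
  ext1 i j
  rw [homogeneousMatrix_apply, Matrix.mul_apply, s.entry_comp k, map_sum, Finset.sum_smul]
  refine Finset.sum_congr rfl fun q _ => ?_
  rw [l.mul, homogeneousMatrix_apply, homogeneousMatrix_apply, smul_mul_smul_comm, ← T_add,
    neg_add]

variable [∀ n : ℤ, (shiftFunctor C n).Linear k]

/-- The matrix representation of the graded endomorphism algebra. -/
noncomputable def matrixHom : EndStar G →ₐ[k] Matrix (Fin m) (Fin m) k[T;T⁻¹] :=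
  DirectSum.toAlgebra k (EndDeg G) (degreeMatrix s l)
    (homogeneousMatrix_one s l) (homogeneousMatrix_comp s l)

theorem matrixHom_of (n : ℤ) (f : EndDeg G n) :
    matrixHom s l (DirectSum.of (EndDeg G) n f) = degreeMatrix s l n f :=
  DirectSum.toAddMonoid_of _ _ _

/-- Different degrees contribute different powers of `x`, so nothing cancels and each homogeneous
component can be read off the matrix. Injectivity and the comparison of gradings both rest on this.
-/
theorem coeff_matrixHom (a : EndStar G) (i j : Fin m) (n : ℤ) :
    (matrixHom s l a i j).coeff (-n) = l.coord i j n (s.degEntry k i j n (a n)) := by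
  induction a using DirectSum.induction_on with
  | zero => simp
  | add a b ha hb => simp [Matrix.add_apply, ha, hb]
  | of p f =>
    rw [matrixHom_of, degreeMatrix_apply]
    by_cases h : p = n
    · subst h
      simp
    · rw [DirectSum.of_eq_of_ne _ _ _ (Ne.symm h)]
      simp [h]

theorem matrixHom_injective : Function.Injective (matrixHom s l) := by
  refine (injective_iff_map_eq_zero _).2 fun a ha => ?_
  refine DFinsupp.ext fun n => s.eq_zero_of_entry k (a n) fun i j => l.eq_zero _ _ _ _ ?_
  change l.coord i j n (s.degEntry k i j n (a n)) = 0
  rw [← coeff_matrixHom, ha]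
  simp

theorem mem_homogeneous_iff_matrixHom (n : ℤ) (a : EndStar G) :
    a ∈ EndStar.homogeneous k G n ↔ ∀ i j, ∃ c : k, matrixHom s l a i j = c • T (-n) := by
  constructor
  · rintro ⟨f, rfl⟩ i j
    exact ⟨_, congrFun (congrFun (matrixHom_of s l n f) i) j⟩
  · intro h
    -- The only possible preimage is the degree `n` component of `a`; the other coefficients vanish
    -- by hypothesis.
    refine ⟨a n, matrixHom_injective s l ?_⟩
    ext i j p
    obtain ⟨p, rfl⟩ : ∃ q, p = -q := ⟨-p, by simp⟩
    rw [coeff_matrixHom, coeff_matrixHom]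
    by_cases hp : p = n
    · subst hp
      rw [DirectSum.lof_eq_of, DirectSum.of_eq_same]
    · rw [DirectSum.lof_eq_of, DirectSum.of_eq_of_ne _ _ _ hp, ← coeff_matrixHom]
      obtain ⟨c, hc⟩ := h i j
      simp [hc, Ne.symm hp]

/-- Extended by zero to `G`, the map `f` has a single nonzero matrix entry; dividing by its
coordinate normalises it. These matrices supply surjectivity. -/
theorem single_mem_range_matrixHom {i j : Fin m} {n : ℤ} {f : ShiftedHom (H j) (H i) n}
    (hf : f ≠ 0) (c : k) :
    Matrix.single i j (LaurentPolynomial.C c * T (-n)) ∈ (matrixHom s l).range := by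
  have hl : l.coord i j n f ≠ 0 := fun h => hf (l.eq_zero _ _ _ _ h)
  let f' : ShiftedHom G G n := s.proj j ≫ f ≫ (s.inc i)⟦n⟧'
  refine ⟨(c / l.coord i j n f) • DirectSum.of (EndDeg G) n (EndDeg.ofHom f'), ?_⟩
  have entry : ∀ p q, s.degEntry k p q n (EndDeg.ofHom f') =
      (s.inc q ≫ s.proj j) ≫ f ≫ (s.inc i ≫ s.proj p)⟦n⟧' := fun p q => by
    change s.entry k p q n f' = _
    simp [f', Splitting.entry_apply]
  change matrixHom s l _ = _
  rw [_root_.map_smul, matrixHom_of]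
  ext1 p q
  rw [Matrix.smul_apply, degreeMatrix_apply, entry]
  by_cases hp : i = p
  · by_cases hq : j = q
    · subst hp hq
      rw [s.inc_proj_self, s.inc_proj_self, Matrix.single_apply_same, smul_smul,
        LaurentPolynomial.smul_eq_C_mul]
      simp [hl]
    · rw [s.inc_proj_ne _ _ (Ne.symm hq)]
      simp [hq]
  · rw [s.inc_proj_ne _ _ hp]
    simp [hp]

/-- If the nonzero graded morphism spaces between the `H i` are those prescribed by `chi`, then
the graded endomorphism algebra is isomorphic to `chi`. -/
theorem exists_algEquiv_chi (s : Splitting G H) (l : Coordinates k H) (S : Fin m → Prop)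
    (low : ∀ i j, j < i → ∀ (n : ℤ) (f : ShiftedHom (H j) (H i) n), f = 0)
    (diag : ∀ i, S i → ∀ (n : ℤ), 0 < n → ∀ f : ShiftedHom (H i) (H i) n, f = 0)
    (up_ne : ∀ i j, i < j → ∀ n : ℤ, ∃ f : ShiftedHom (H j) (H i) n, f ≠ 0)
    (diag_ne : ∀ i, ∀ n : ℤ, ¬ S i ∨ n ≤ 0 → ∃ f : ShiftedHom (H i) (H i) n, f ≠ 0) :
    ∃ φ : EndStar G ≃ₐ[k] chi k S, ∀ (n : ℤ) (a : EndStar G),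
      a ∈ EndStar.homogeneous k G n ↔ φ a ∈ chi.homogeneous k S n := by
  have mem : ∀ a, matrixHom s l a ∈ chi k S := by
    intro a
    induction a using DirectSum.induction_on with
    | zero => rw [_root_.map_zero]; exact zero_mem _
    | add a b ha hb => rw [_root_.map_add]; exact add_mem ha hb
    | of n f =>
      rw [matrixHom_of]
      refine ⟨fun i j hij => ?_, fun i hi => ?_⟩
      · rw [degreeMatrix_apply, low i j hij n (s.degEntry k i j n f), _root_.map_zero, zero_smul]
      · rw [degreeMatrix_apply]
        rcases lt_or_ge 0 n with hn | hn
        · rw [diag i hi n hn (s.degEntry k i i n f), _root_.map_zero, zero_smul]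
          exact zero_mem _
        · have hT : T (-n) ∈ (Polynomial.toLaurentAlg (R := k)).range := by
            refine ⟨Polynomial.X ^ (-n).toNat, ?_⟩
            change Polynomial.toLaurent _ = _
            rw [Polynomial.toLaurent_X_pow]
            congr 1
            omega
          exact Subalgebra.smul_mem _ hT _
  -- Surjectivity is checked one entry and one monomial at a time: `full` handles entries in `k[x,
  -- x⁻¹]`, and `half` the diagonal entries confined to `k[x]`.
  have full : ∀ i j, (∀ n : ℤ, ∃ f : ShiftedHom (H j) (H i) n, f ≠ 0) → ∀ p,
      Matrix.single i j p ∈ (matrixHom s l).range := by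
    intro i j h p
    induction p using LaurentPolynomial.induction_on' with
    | add p q hp hq => rw [Matrix.single_add]; exact add_mem hp hq
    | C_mul_T n c =>
      obtain ⟨f, hf⟩ := h (-n)
      simpa using single_mem_range_matrixHom s l hf c
  have half : ∀ i, S i → ∀ q : Polynomial k,
      Matrix.single i i (Polynomial.toLaurent q) ∈ (matrixHom s l).range := by
    intro i hi q
    induction q using Polynomial.induction_on' with
    | add p q hp hq => rw [_root_.map_add, Matrix.single_add]; exact add_mem hp hq
    | monomial n c =>
      obtain ⟨f, hf⟩ := diag_ne i (-n) (Or.inr (by omega))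
      rw [← Polynomial.C_mul_X_pow_eq_monomial, Polynomial.toLaurent_C_mul_X_pow]
      simpa using single_mem_range_matrixHom s l hf c
  have surj : ∀ M ∈ chi k S, M ∈ (matrixHom s l).range := by
    rintro M ⟨hM, hM'⟩
    rw [Matrix.matrix_eq_sum_single M]
    refine sum_mem fun i _ => sum_mem fun j _ => ?_
    rcases lt_trichotomy i j with h | h | h
    · exact full i j (up_ne i j h) _
    · subst h
      by_cases hS : S i
      · obtain ⟨q, hq⟩ := hM' i hS
        change Polynomial.toLaurent q = _ at hq
        rw [← hq]
        exact half i hS q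
      · exact full i i (fun n => diag_ne i n (Or.inl hS)) _
    · rw [hM i j h, Matrix.single_zero]
      exact zero_mem _
  refine ⟨AlgEquiv.ofBijective ((matrixHom s l).codRestrict (chi k S) mem)
    ⟨fun a b h => matrixHom_injective s l (congrArg Subtype.val h), fun M => ?_⟩, fun n a => ?_⟩
  · obtain ⟨a, ha⟩ := surj M M.2
    exact ⟨a, Subtype.ext ha⟩
  · exact mem_homogeneous_iff_matrixHom s l n a

end MatrixAlgebra
end LinGen

/-! ### The graded endomorphism algebra of a minimal linear generator -/

namespace LinGen

/-- For a linear generator `G` that is the direct sum of indecomposable objects `P i`, increasing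
for `≤` and pairwise not isomorphic up to shift, the graded endomorphism algebra is `chi`. -/
theorem IsLinearGenerator.exists_algEquiv {k : Type w} [Field k] {C : Type u} [Category.{v} C]
    [Preadditive C] [Linear k C] [HasZeroObject C] [HasShift C ℤ]
    [∀ n : ℤ, (shiftFunctor C n).Additive] [∀ n : ℤ, (shiftFunctor C n).Linear k]
    [Pretriangulated C] {G : C} (lin : IsLinearGenerator k G) {m : ℕ} {P : Fin m → C}
    (s : Splitting G P) (ind : ∀ i, IsInd G (P i)) (ind_shift : ∀ i (n : ℤ), IsInd G ((P i)⟦n⟧))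
    (lt : ∀ i j, i < j → LinLE k (P i) (P j))
    (not_iso : ∀ i j, i ≠ j → ∀ n : ℤ, ¬ Nonempty (P i ≅ (P j)⟦n⟧)) :
    ∃ φ : EndStar G ≃ₐ[k] chi k (fun i => LinLT k (P i) ((P i)⟦(1 : ℤ)⟧)),
      ∀ (n : ℤ) (a : EndStar G),
        a ∈ EndStar.homogeneous k G n ↔ φ a ∈ chi.homogeneous k _ n := by
  have up : ∀ i j, i < j → ∀ n : ℤ, LinLE k ((P i)⟦n⟧) (P j) := fun i j hij =>
    lin.linLE_shift_of_linLE (ind j) (ind_shift i) (not_iso j i hij.ne') (lt i j hij)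
  have hl : Nonempty (Coordinates k P) := by
    rcases Nat.eq_zero_or_pos m with rfl | hm
    · exact ⟨⟨fun i => i.elim0, fun i => i.elim0, fun i => i.elim0, fun i => i.elim0⟩⟩
    -- The least summand receives a nonzero degree `0` map from every summand, and the axiom
    -- `le_shift` yields its endomorphism `x` of degree `-1`.
    · let o : Fin m := ⟨0, hm⟩
      have hy : ∀ i, LinLE k ((P o)⟦(0 : ℤ)⟧) (P i) := fun i => by
        rcases (show o ≤ i from Nat.zero_le _).eq_or_lt with h | h
        · rw [← h]
          exact lin.linLE_shift_nonpos (ind_shift o) le_rfl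
        · exact up o i h 0
      obtain ⟨x, hx⟩ := (lin.linLE_shift_nonpos (ind_shift o) (n := -1) (by omega)).exists_ne_zero
      choose y hy' using fun i => (hy i).exists_ne_zero
      obtain ⟨l, h1, h2, h3⟩ := exists_multiplicative_coordinates (k := k) P o
        (fun i j n f g hf =>
          (lin.linLE_of_ne_zero (ind j) (ind_shift i n) hf).exists_smul hf g)
        (fun i p j a b c h f g hf hg =>
          lin.shiftedHom_comp_ne_zero (ind j) (ind_shift p) (ind_shift i) hf hg h) x hx y hy'
      exact ⟨⟨l, h1, h2, h3⟩⟩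
  obtain ⟨l⟩ := hl
  refine exists_algEquiv_chi s l _ (fun i j hji n f => ?_) (fun i hi n hn f => ?_)
    (fun i j hij n => (up i j hij n).exists_ne_zero) (fun i n hn => ?_)
  · exact lin.hom_shift_eq_zero_of_linLE (ind i) (ind_shift j) (not_iso i j hji.ne')
      (lt j i hji) n f
  · exact lin.hom_shift_eq_zero_of_linLT (ind i) (ind_shift i) hi hn f
  · rcases hn with hS | hn
    · exact (lin.linLE_shift_of_not_linLT (ind i) (ind_shift i) hS n).exists_ne_zero
    · exact (lin.linLE_shift_nonpos (ind_shift i) hn).exists_ne_zero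

end LinGen

theorem mainTheorem4 {k : Type w} [Field k] {C : Type u} [Category.{v} C] [Preadditive C]
    [Linear k C] [HasZeroObject C] [HasShift C ℤ] [∀ n : ℤ, (shiftFunctor C n).Additive]
    [∀ n : ℤ, (shiftFunctor C n).Linear k] [Pretriangulated C] [IsTriangulated C]
    (hom_finite : ∀ X Y : C, Module.Finite k (X ⟶ Y))
    (krull_schmidt : LinGen.KrullSchmidt C)
    (G : C) (linear : LinGen.IsLinearGenerator k G) (minimal : LinGen.IsMinimalGenerator G)
    {m : ℕ} (H : Fin m → C) (indecomposable : ∀ i, Indecomposable (H i))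
    (decomposition : Nonempty (G ≅ biproduct H)) :
    ∃ σ : Equiv.Perm (Fin m),
      (∀ i j, i < j → LinGen.LinLT k (H (σ i)) (H (σ j))) ∧
      ∃ φ : LinGen.EndStar G ≃ₐ[k]
          LinGen.chi k (fun i => LinGen.LinLT k (H (σ i)) ((H (σ i))⟦(1 : ℤ)⟧)),
        ∀ (n : ℤ) (a : LinGen.EndStar G),
          a ∈ LinGen.EndStar.homogeneous k G n ↔ φ a ∈ LinGen.chi.homogeneous k _ n := by
  obtain ⟨e⟩ := decomposition
  have ret : ∀ i, Retract (H i) G := fun i =>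
    { i := biproduct.ι H i ≫ e.inv
      r := e.hom ≫ biproduct.π H i }
  have ind : ∀ i, LinGen.IsInd G (H i) := fun i => .of_retract (indecomposable i) (ret i)
  have ind_shift : ∀ i (n : ℤ), LinGen.IsInd G ((H i)⟦n⟧) := fun i n => (ind i).shift n ⟨ret i⟩
  have not_iso : ∀ i j, i ≠ j → ∀ n : ℤ, ¬ Nonempty (H i ≅ (H j)⟦n⟧) := fun i j hij n =>
    LinGen.not_iso_shift_of_minimal minimal indecomposable e hij n
  obtain ⟨σ, hσ⟩ := LinGen.exists_perm_of_total (fun i j => LinGen.LinLE k (H i) (H j))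
    (fun i j => linear.total _ _ (ind i) (ind j))
    (fun i j l => linear.trans _ _ _ (ind i) (ind j) (ind l))
  have hne : ∀ {i j}, i ≠ j → σ i ≠ σ j := fun h h' => h (σ.injective h')
  refine ⟨σ, fun i j hij => ⟨hσ i j hij, fun ⟨e'⟩ => ?_⟩, ?_⟩
  -- Strictness is the case of shift `0` in the separation of summands.
  · exact not_iso _ _ (hne hij.ne) 0 ⟨e' ≪≫ (LinGen.shiftZeroIso _).symm⟩
  · exact linear.exists_algEquiv (.ofIso e σ) (fun i => ind _) (fun i => ind_shift _) hσ
      (fun i j hij => not_iso _ _ (hne hij))
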